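/- For a (Lebesgue) measurable set $A\subseteq\mathbb{R}^2$ let $$\overline{\delta}(A):=\limsup_{R\to\infty}\ \sup_{x\in\mathbb{R}^2}\frac{|A\cap(x+[0,R]^2)|}{R^2}$$ denote its upper Banach density, where $|\cdot|$ of a set is its Lebesgue measure, and let $|v|$ denote the Euclidean norm of a vector $v\in\mathbb{R}^2$. Let $\mathcal{T}=(V,E)$ be a finite tree, and let real numbers $a_k,b_k>0$ be given for each edge $k\in E$. For every measurable set $A\subseteq\mathbb{R}^2$ satisfying $\overline{\delta}(A)>0$ there is a positive number $\lambda_0$, depending on $A$, $\mathcal{T}$, $(a_k)_{k\in E}$ and $(b_k)_{k\in E}$, such that for each $\lambda\in[\lambda_0,\infty)$ one can find pairwise distinct points $x_v\in A$, one for each vertex $v\in V$, satisfying $$|x_u-x_v|=\lambda^{a_k}b_k\quad\text{for each edge }k\in E\text{ joining vertices }u,v\in V.$$ In other words, for each $\lambda\in[\lambda_0,\infty)$ the set $A$ contains an embedding of the distance tree combinatorially isomorphic to $\mathcal{T}$ and having the numbers $\lambda^{a_k}b_k$ as lengths of its edges. -/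

import Mathlib

/-- The axis-parallel closed cube `x + [0, R]^d` in `ℝ^d`. -/
def cornerCube {d : ℕ} (x : EuclideanSpace ℝ (Fin d)) (R : ℝ) :
    Set (EuclideanSpace ℝ (Fin d)) :=
  {y | ∀ i, y i ∈ Set.Icc (x i) (x i + R)}

/-- The upper Banach density
`limsup_{R → ∞} sup_{x ∈ ℝ^d} |A ∩ (x + [0, R]^d)| / R^d` of a set `A ⊆ ℝ^d`.
It takes values in `[0, ∞]`, so that the supremum and the upper limit always exist. -/
noncomputable def upperBanachDensity {d : ℕ} (A : Set (EuclideanSpace ℝ (Fin d))) : ENNReal :=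
  Filter.limsup
    (fun R : ℝ => ⨆ x : EuclideanSpace ℝ (Fin d),
      MeasureTheory.volume (A ∩ cornerCube x R) / ENNReal.ofReal (R ^ d))
    Filter.atTop

/-!
The argument is a second moment computation; it uses no Fourier analysis. Let `δ > 0` be the upper
Banach density of `A`. For a distance `l`, the function `arcAverage l S x` is the proportion of
points `x + l • arc t`, with `arc` a quarter of the unit circle, that lie in `S`.

By definition of the density, *every* large cube has density at most `δ + ε / 2`, while some
arbitrarily large cube `Q` has density at least `δ - ε`. Put `S = A ∩ Q`, with `Q` much larger than
all edge lengths. The integral of `arcAverage l S` is `|S|`. Its second moment is the integral over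
`S` of the mass which the law of `arc s - arc t`, for independent uniform `s` and `t`, dilated by
`l` and centred at a point of `S`, gives to `S`. This law is absolutely continuous
(`arc_difference_absolutelyContinuous`), so at large scales `l` it is nearly a mixture of uniform
laws on large cubes, and that mass is at most `δ + ε` at *every* centre
(`exists_forall_dilated_law_le`). Hence `arcAverage l S` has small variance around `δ` and is at
least `δ / 2` at all points of `S` outside a set of tiny relative measure
(`volume_arcAverage_lt_le`).

It remains to pass from one edge to a tree. Discard from `S` the points that fail, for some edge
length, to have a positive proportion of neighbours in `S`, and repeat this with the remaining set
as many times as the tree has edges. Averaging over arcs preserves total mass, so the discarded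
measure stays a bounded multiple, depending only on `δ` and the number of edges, of the measure of
the exceptional sets above, and for `ε` small something remains (`exists_nested_sets`). Placing one
vertex there and attaching the others one leaf at a time, each from the next larger set, embeds the
tree (`exists_embedding_of_isTree`); at every step infinitely many points are available, so that the
vertices can be kept distinct.
-/

open MeasureTheory Filter Topology Set
open scoped ENNReal

/-! ### A circular arc and the law of its differences -/

/-- The Euclidean plane. -/
abbrev Plane := EuclideanSpace ℝ (Fin 2)

/-- The open unit arc in the first quadrant, parametrised as the graph of `√(1 - t²)` over
`t ∈ (0, 1)`. -/
noncomputable def arc (t : ℝ) : Plane := !₂[t, √(1 - t ^ 2)]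

@[simp] lemma arc_zero_apply (t : ℝ) : arc t 0 = t := rfl

@[simp] lemma arc_one_apply (t : ℝ) : arc t 1 = √(1 - t ^ 2) := rfl

lemma arc_injective : Function.Injective arc := fun s t h => by
  simpa using congrArg (fun x : Plane => x 0) h

lemma norm_arc {t : ℝ} (ht : t ∈ Ioo (0 : ℝ) 1) : ‖arc t‖ = 1 := by
  have h : (0 : ℝ) ≤ 1 - t ^ 2 := by nlinarith [ht.1, ht.2]
  rw [EuclideanSpace.norm_eq]
  simp [Fin.sum_univ_two, Real.sq_sqrt h]

@[fun_prop] lemma continuous_arc : Continuous arc := by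
  unfold arc
  refine (PiLp.continuous_toLp 2 _).comp (continuous_pi fun i => ?_)
  fin_cases i
  · exact continuous_id
  · exact Real.continuous_sqrt.comp (by fun_prop)

lemma arc_mem_Icc {t : ℝ} (ht : t ∈ Ioo (0 : ℝ) 1) (i : Fin 2) : arc t i ∈ Icc (0 : ℝ) 1 := by
  fin_cases i
  · exact ⟨ht.1.le, ht.2.le⟩
  · exact ⟨Real.sqrt_nonneg _, Real.sqrt_le_one.2 (by nlinarith [ht.1])⟩

/-- A real function whose derivative does not vanish on an interval pulls null sets back to
null sets. -/
lemma volume_inter_preimage_eq_zero {g : ℝ → ℝ} {s : Set ℝ} (hs : s.OrdConnected)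
    (hg : Measurable g) (hd : ∀ x ∈ s, DifferentiableAt ℝ g x) (h0 : ∀ x ∈ s, deriv g x ≠ 0)
    {N : Set ℝ} (hN : MeasurableSet N) (hN0 : volume N = 0) :
    volume (s ∩ g ⁻¹' N) = 0 := by
  have hinj : InjOn g s := by
    -- By Rolle's theorem.
    have key : ∀ x ∈ s, ∀ y ∈ s, x < y → g x ≠ g y := fun x hx y hy hxy h => by
      have hsub : Icc x y ⊆ s := hs.out hx hy
      obtain ⟨c, hc, hc'⟩ := exists_deriv_eq_zero hxy
        (fun z hz => (hd z (hsub hz)).continuousAt.continuousWithinAt) h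
      exact h0 c (hsub (Ioo_subset_Icc_self hc)) hc'
    intro x hx y hy h
    rcases lt_trichotomy x y with hxy | hxy | hxy
    · exact absurd h (key x hx y hy hxy)
    · exact hxy
    · exact absurd h.symm (key y hy x hx hxy)
  have hm : MeasurableSet (s ∩ g ⁻¹' N) := hs.measurableSet.inter (hg hN)
  have h1 := lintegral_image_eq_lintegral_abs_deriv_mul hm
    (fun x hx => (hd x hx.1).hasDerivAt.hasDerivWithinAt) (hinj.mono inter_subset_left) 1
  have h2 : volume (g '' (s ∩ g ⁻¹' N)) = 0 :=
    measure_mono_null (by rintro _ ⟨x, hx, rfl⟩; exact hx.2) hN0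
  simp only [Pi.one_apply, mul_one, lintegral_one, Measure.restrict_apply, MeasurableSet.univ,
    univ_inter, h2] at h1
  have h3 := (lintegral_eq_zero_iff ((measurable_deriv g).abs.ennreal_ofReal)).1 h1.symm
  have h4 := (ae_restrict_iff' hm).1 h3
  rw [← compl_mem_ae_iff]
  filter_upwards [h4] with x hx hxs
  have := hx hxs
  simp only [Pi.zero_apply, ENNReal.ofReal_eq_zero] at this
  exact h0 x hxs.1 (abs_eq_zero.1 (le_antisymm this (abs_nonneg _)))

lemma hasDerivAt_sqrt_one_sub_sq {t : ℝ} (ht : t ∈ Ioo (0 : ℝ) 1) :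
    HasDerivAt (fun t : ℝ => √(1 - t ^ 2)) (-(t / √(1 - t ^ 2))) t := by
  have h : (0 : ℝ) < 1 - t ^ 2 := by nlinarith [ht.1, ht.2]
  have h1 : HasDerivAt (fun t : ℝ => 1 - t ^ 2) (-(2 * t)) t := by
    simpa using ((hasDerivAt_id t).pow 2).const_sub 1
  convert h1.sqrt h.ne' using 1
  field_simp

lemma strictMonoOn_div_sqrt_one_sub_sq :
    StrictMonoOn (fun t : ℝ => t / √(1 - t ^ 2)) (Ioo 0 1) := fun s hs t ht hst => by
  have h : (0 : ℝ) < 1 - t ^ 2 := by nlinarith [ht.1, ht.2]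
  exact div_lt_div₀ hst (Real.sqrt_le_sqrt (by nlinarith [hs.1])) ht.1.le (Real.sqrt_pos.2 h)

/-- The law of the difference `arc s - arc t` of two independent uniform points of the arc is
absolutely continuous. For fixed `p = s - t ≠ 0` the second coordinate
`√(1 - (t + p)²) - √(1 - t²)` has non-vanishing derivative in `t`, by strict concavity of the
circle, so Fubini's theorem in the variables `(p, t)` applies. -/
lemma arc_difference_absolutelyContinuous :
    ((volume.restrict (Ioo (0 : ℝ) 1)).prod (volume.restrict (Ioo (0 : ℝ) 1))).map
      (fun z : ℝ × ℝ => arc z.1 - arc z.2) ≪ (volume : Measure Plane) := by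
  refine Measure.AbsolutelyContinuous.mk fun N hN hN0 => ?_
  have hmeas : Measurable (fun z : ℝ × ℝ => arc z.1 - arc z.2) := by fun_prop
  rw [Measure.map_apply hmeas hN, Measure.prod_restrict, Measure.restrict_apply (hmeas hN)]
  let e : ℝ × ℝ → Plane := fun z => WithLp.toLp 2 (MeasurableEquiv.finTwoArrow.symm z)
  have he : MeasurePreserving e :=
    (PiLp.volume_preserving_toLp (Fin 2)).comp ((volume_preserving_finTwoArrow ℝ).symm _)
  have hM0 : (volume : Measure (ℝ × ℝ)) (e ⁻¹' N) = 0 := by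
    rw [he.measure_preimage hN.nullMeasurableSet, hN0]
  have hM : MeasurableSet (e ⁻¹' N) := he.measurable hN
  let φ : ℝ → ℝ := fun t => √(1 - t ^ 2)
  have hφ : Measurable φ := by fun_prop
  let W : Set (ℝ × ℝ) := {z | z.2 ∈ Ioo (0 : ℝ) 1 ∧ z.2 + z.1 ∈ Ioo (0 : ℝ) 1 ∧
    (z.1, φ (z.2 + z.1) - φ z.2) ∈ e ⁻¹' N}
  have hWm : MeasurableSet W := by
    refine (measurableSet_Ioo.preimage measurable_snd).inter
      ((measurableSet_Ioo.preimage (measurable_snd.add measurable_fst)).inter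
      (hM.preimage ?_))
    fun_prop
  have hW : (volume : Measure (ℝ × ℝ)) W = 0 := by
    rw [Measure.volume_eq_prod, Measure.measure_prod_null hWm]
    rw [Measure.volume_eq_prod] at hM0
    have hne : ∀ᵐ p : ℝ, p ≠ 0 := by simp [ae_iff]
    filter_upwards [(Measure.measure_prod_null hM).1 hM0, hne] with p hp hp0
    have hs : ((Ioo (0 : ℝ) 1) ∩ (· + p) ⁻¹' (Ioo 0 1)).OrdConnected :=
      ordConnected_Ioo.inter (ordConnected_Ioo.preimage_mono (fun a b h => by simpa using h))
    have hder : ∀ t ∈ (Ioo (0 : ℝ) 1) ∩ (· + p) ⁻¹' (Ioo 0 1),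
        HasDerivAt (fun t => φ (t + p) - φ t)
          (-((t + p) / √(1 - (t + p) ^ 2)) - -(t / √(1 - t ^ 2))) t := fun t ht =>
      ((hasDerivAt_sqrt_one_sub_sq ht.2).comp_add_const t p).sub (hasDerivAt_sqrt_one_sub_sq ht.1)
    have := volume_inter_preimage_eq_zero (g := fun t => φ (t + p) - φ t) hs (by fun_prop)
      (fun t ht => (hder t ht).differentiableAt)
      (fun t ht => by
        rw [(hder t ht).deriv]
        intro h
        have h' : (t + p) / √(1 - (t + p) ^ 2) = t / √(1 - t ^ 2) := by linarith
        exact hp0 (by simpa using strictMonoOn_div_sqrt_one_sub_sq.injOn ht.2 ht.1 h'))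
      (measurable_prodMk_left hM) hp
    refine measure_mono_null ?_ this
    exact fun t ht => ⟨⟨ht.1, ht.2.1⟩, ht.2.2⟩
  have hsub : MeasurePreserving (fun z : ℝ × ℝ => (z.1 - z.2, z.2))
      (volume : Measure (ℝ × ℝ)) volume := measurePreserving_sub_prod volume volume
  have h5 := hsub.measure_preimage hWm.nullMeasurableSet
  rw [hW] at h5
  refine measure_mono_null ?_ h5
  rintro ⟨s, t⟩ ⟨h, hs, ht⟩
  refine ⟨ht, by simpa using hs, ?_⟩
  have : e (s - t, φ (t + (s - t)) - φ t) = arc s - arc t := by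
    ext i
    fin_cases i
    · simp [e]
    · simp [e, φ]
  change e (s - t, φ (t + (s - t)) - φ t) ∈ N
  rw [this]
  exact h

/-! ### Dilates of absolutely continuous laws -/

/-- Translation is continuous in total variation at an absolutely continuous measure. -/
lemma exists_measureReal_le_translate_add {ρ : Measure Plane} [IsFiniteMeasure ρ]
    (hρ : ρ ≪ volume) {η : ℝ} (hη : 0 < η) :
    ∃ θ > 0, ∀ t : Plane, ‖t‖ < θ → ∀ S : Set Plane, MeasurableSet S →
      ρ.real S ≤ ρ.real {w | w + t ∈ S} + η := by
  let h : Plane → ℝ := fun w => (ρ.rnDeriv volume w).toReal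
  have hint : Integrable h := Measure.integrable_toReal_rnDeriv
  let F : Lp ℝ 1 (volume : Measure Plane) := hint.toL1 h
  let g : C(Plane, C(Plane, Plane)) :=
    ContinuousMap.curry ⟨fun p : Plane × Plane => p.2 - p.1, by fun_prop⟩
  have hg : ∀ t, MeasurePreserving (g t) (volume : Measure Plane) volume := fun t =>
    measurePreserving_sub_right volume t
  have hcont : Continuous fun t => Lp.compMeasurePreserving (g t) (hg t) F :=
    continuous_const.compMeasurePreservingLp g.continuous hg ENNReal.one_ne_top
  obtain ⟨θ, hθ, H⟩ := Metric.continuousAt_iff.1 (hcont.continuousAt (x := 0)) η hη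
  refine ⟨θ, hθ, fun t ht S hS => ?_⟩
  have hF : (F : Plane → ℝ) =ᵐ[volume] h := hint.coeFn_toL1
  have hF' : ∀ t, (Lp.compMeasurePreserving (g t) (hg t) F : Plane → ℝ) =ᵐ[volume]
      fun w => h (w - t) := fun t =>
    (Lp.coeFn_compMeasurePreserving F (hg t)).trans ((hg t).quasiMeasurePreserving.ae_eq_comp hF)
  have hd := H (x := t) (by simpa using ht)
  have hint' : Integrable fun w => h (w - t) := hint.comp_sub_right t
  have hnorm : dist (Lp.compMeasurePreserving (g t) (hg t) F)
      (Lp.compMeasurePreserving (g 0) (hg 0) F) = ∫ w, |h (w - t) - h w| := by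
    rw [dist_eq_norm, L1.norm_eq_integral_norm]
    refine integral_congr_ae ?_
    filter_upwards [hF' t, hF' 0, Lp.coeFn_sub (Lp.compMeasurePreserving (g t) (hg t) F)
      (Lp.compMeasurePreserving (g 0) (hg 0) F)] with w h1 h2 h3
    rw [h3, Pi.sub_apply, h1, h2, sub_zero, Real.norm_eq_abs]
  rw [hnorm] at hd
  have hS' : MeasurableSet {w : Plane | w + t ∈ S} := (measurable_add_const t) hS
  have e1 : ρ.real S = ∫ w in S, h w := by
    rw [Measure.setIntegral_toReal_rnDeriv hρ]
  have e2 : ρ.real {w | w + t ∈ S} = ∫ w in S, h (w - t) := by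
    rw [← Measure.setIntegral_toReal_rnDeriv hρ, ← integral_indicator hS',
      ← integral_sub_right_eq_self _ t, ← integral_indicator hS]
    refine integral_congr_ae (Eventually.of_forall fun w => ?_)
    by_cases hw : w ∈ S <;> simp [indicator, hw, h]
  rw [e1, e2]
  have : (∫ w in S, h w) - ∫ w in S, h (w - t) ≤ ∫ w, |h (w - t) - h w| := by
    rw [← integral_sub hint.integrableOn hint'.integrableOn]
    calc ∫ w in S, (h w - h (w - t)) ≤ ∫ w in S, |h (w - t) - h w| :=
          setIntegral_mono (hint.sub hint').integrableOn (hint'.sub hint).abs.integrableOn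
            fun w => by rw [abs_sub_comm]; exact le_abs_self _
      _ ≤ _ := setIntegral_le_integral (hint'.sub hint).abs
          (Eventually.of_forall fun w => abs_nonneg _)
  linarith

lemma cornerCube_eq_preimage {d : ℕ} (x : EuclideanSpace ℝ (Fin d)) (R : ℝ) :
    cornerCube x R = WithLp.ofLp ⁻¹' (Icc x.ofLp (fun i => x i + R)) := by
  ext y
  simp [cornerCube, Pi.le_def, forall_and]

lemma measurableSet_cornerCube {d : ℕ} (x : EuclideanSpace ℝ (Fin d)) (R : ℝ) :
    MeasurableSet (cornerCube x R) := by
  rw [cornerCube_eq_preimage]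
  exact (PiLp.volume_preserving_ofLp (Fin d)).measurable measurableSet_Icc

lemma volume_cornerCube {d : ℕ} (x : EuclideanSpace ℝ (Fin d)) {R : ℝ} (hR : 0 ≤ R) :
    volume (cornerCube x R) = ENNReal.ofReal (R ^ d) := by
  rw [cornerCube_eq_preimage,
    (PiLp.volume_preserving_ofLp (Fin d)).measure_preimage measurableSet_Icc.nullMeasurableSet,
    Real.volume_Icc_pi]
  simp [ENNReal.ofReal_pow hR]

lemma norm_lt_of_mem_cornerCube_zero {θ : ℝ} (hθ : 0 < θ) {t : Plane}
    (ht : t ∈ cornerCube 0 (θ / 2)) : ‖t‖ < θ := by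
  have h0 := ht 0
  have h1 := ht 1
  simp only [PiLp.zero_apply, zero_add, mem_Icc] at h0 h1
  rw [EuclideanSpace.norm_eq, Fin.sum_univ_two, Real.sqrt_lt' hθ]
  simp only [Real.norm_eq_abs, sq_abs]
  nlinarith [h0.1, h0.2, h1.1, h1.2]

/-- If a set has density at most `κ` in every large cube, then every large dilate of a fixed
absolutely continuous probability law gives every translate of it mass at most `κ + η`: the law
is close to its average over the translations by a small cube, and dilation turns that small
cube into a large one. -/
lemma exists_forall_dilated_law_le {ρ : Measure Plane} [IsProbabilityMeasure ρ]
    (hρ : ρ ≪ volume) {A : Set Plane} (hA : MeasurableSet A) {κ L₀ : ℝ} (hκ : 0 ≤ κ)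
    (hcube : ∀ L, L₀ ≤ L → ∀ x, volume (A ∩ cornerCube x L) ≤ ENNReal.ofReal (κ * L ^ 2))
    {η : ℝ} (hη : 0 < η) :
    ∃ l₀ : ℝ, 0 < l₀ ∧ ∀ l, l₀ ≤ l → ∀ x, ρ {w | x + l • w ∈ A} ≤ ENNReal.ofReal (κ + η) := by
  obtain ⟨θ, hθ, H⟩ := exists_measureReal_le_translate_add hρ hη
  have hθ2 : 0 < θ / 2 := by positivity
  refine ⟨max 1 (L₀ / (θ / 2)), by positivity, fun l hl x => ?_⟩
  have hl0 : 0 < l := lt_of_lt_of_le one_pos ((le_max_left _ _).trans hl)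
  have hL : L₀ ≤ l * (θ / 2) := by
    have := (le_max_right _ _).trans hl
    rwa [div_le_iff₀ hθ2] at this
  set S : Set Plane := {w | x + l • w ∈ A} with hSdef
  have hS : MeasurableSet S := hA.preimage (by fun_prop)
  set C : Set Plane := cornerCube 0 (θ / 2) with hCdef
  have hC : MeasurableSet C := measurableSet_cornerCube _ _
  have hCvol : volume C = ENNReal.ofReal ((θ / 2) ^ 2) := volume_cornerCube _ hθ2.le
  have hT : MeasurableSet {p : Plane × Plane | p.2 + p.1 ∈ S} := hS.preimage (by fun_prop)
  have h1 : ∀ t ∈ C, ρ S ≤ ρ {w | w + t ∈ S} + ENNReal.ofReal η := fun t ht => by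
    have := H t (norm_lt_of_mem_cornerCube_zero hθ ht) S hS
    rw [← ofReal_measureReal (μ := ρ) (s := S),
      ← ofReal_measureReal (μ := ρ) (s := {w | w + t ∈ S}),
      ← ENNReal.ofReal_add measureReal_nonneg hη.le]
    exact ENNReal.ofReal_le_ofReal this
  have h2 : ∫⁻ t in C, ρ {w | w + t ∈ S} = ∫⁻ w, volume.restrict C {t | w + t ∈ S} ∂ρ := by
    have e1 := Measure.prod_apply (μ := volume.restrict C) (ν := ρ) hT
    have e2 := Measure.prod_apply_symm (μ := volume.restrict C) (ν := ρ) hT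
    exact e1.symm.trans e2
  have h3 : ∀ w, volume.restrict C {t | w + t ∈ S} ≤ ENNReal.ofReal (κ * (θ / 2) ^ 2) := by
    intro w
    rw [Measure.restrict_apply' hC]
    have e1 : {t | w + t ∈ S} ∩ C = (l • ·) ⁻¹' ((fun u => (x + l • w) + u) ⁻¹'
        (A ∩ cornerCube (x + l • w) (l * (θ / 2)))) := by
      ext t
      simp only [hSdef, hCdef, cornerCube, mem_inter_iff, mem_ofPred_eq, mem_preimage, smul_add,
        add_assoc, PiLp.add_apply, PiLp.smul_apply, PiLp.zero_apply, mem_Icc, smul_eq_mul,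
        zero_add, add_le_add_iff_left, le_add_iff_nonneg_right, mul_nonneg_iff_of_pos_left hl0,
        mul_le_mul_iff_right₀ hl0]
    rw [e1, Measure.addHaar_preimage_smul _ hl0.ne', measure_preimage_add]
    calc _ ≤ ENNReal.ofReal |(l ^ 2)⁻¹| * ENNReal.ofReal (κ * (l * (θ / 2)) ^ 2) := by
          rw [finrank_euclideanSpace_fin]
          gcongr
          exact hcube _ hL _
      _ = ENNReal.ofReal (κ * (θ / 2) ^ 2) := by
          rw [← ENNReal.ofReal_mul (abs_nonneg _), abs_of_pos (by positivity)]
          congr 1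
          field_simp
  have h4 : ρ S * ENNReal.ofReal ((θ / 2) ^ 2) ≤
      ENNReal.ofReal (κ + η) * ENNReal.ofReal ((θ / 2) ^ 2) := by
    calc ρ S * ENNReal.ofReal ((θ / 2) ^ 2) = ∫⁻ t in C, ρ S := by simp [hCvol]
      _ ≤ ∫⁻ t in C, (ρ {w | w + t ∈ S} + ENNReal.ofReal η) :=
          setLIntegral_mono' hC h1
      _ = ∫⁻ w, volume.restrict C {t | w + t ∈ S} ∂ρ
            + ENNReal.ofReal η * ENNReal.ofReal ((θ / 2) ^ 2) := by
          rw [lintegral_add_right _ measurable_const, h2]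
          simp [hCvol]
      _ ≤ ∫⁻ _, ENNReal.ofReal (κ * (θ / 2) ^ 2) ∂ρ
            + ENNReal.ofReal η * ENNReal.ofReal ((θ / 2) ^ 2) := by
          gcongr with w
          exact h3 w
      _ = _ := by
          rw [lintegral_const, measure_univ, mul_one, ENNReal.ofReal_add hκ hη.le, add_mul,
            ENNReal.ofReal_mul hκ]
  refine (ENNReal.mul_le_mul_iff_left ?_ ENNReal.ofReal_ne_top).1 h4
  simpa using hθ2.ne'

/-! ### Averages over dilated arcs -/

/-- The proportion of parameters `t ∈ (0, 1)` for which the point `x + l • arc t`, at distance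
`l` from `x`, lies in `S`. -/
noncomputable def arcAverage (l : ℝ) (S : Set Plane) (x : Plane) : ℝ≥0∞ :=
  volume.restrict (Ioo (0 : ℝ) 1) {t | x + l • arc t ∈ S}

/-- The law of the difference of two independent uniform points of the arc. -/
noncomputable def arcDifferenceLaw : Measure Plane :=
  ((volume.restrict (Ioo (0 : ℝ) 1)).prod (volume.restrict (Ioo (0 : ℝ) 1))).map
    (fun z : ℝ × ℝ => arc z.1 - arc z.2)

instance isProbabilityMeasure_restrict_Ioo :
    IsProbabilityMeasure (volume.restrict (Ioo (0 : ℝ) 1)) := ⟨by simp⟩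

instance : IsProbabilityMeasure arcDifferenceLaw :=
  Measure.isProbabilityMeasure_map (by fun_prop)

lemma arcAverage_le_one (l : ℝ) (S : Set Plane) (x : Plane) : arcAverage l S x ≤ 1 := prob_le_one

lemma measurable_arcAverage (l : ℝ) {S : Set Plane} (hS : MeasurableSet S) :
    Measurable (arcAverage l S) := by
  have hT : MeasurableSet {p : Plane × ℝ | p.1 + l • arc p.2 ∈ S} := hS.preimage (by fun_prop)
  exact measurable_measure_prodMk_left (ν := volume.restrict (Ioo (0 : ℝ) 1)) hT

lemma lintegral_arcAverage (l : ℝ) {S : Set Plane} (hS : MeasurableSet S) :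
    ∫⁻ x, arcAverage l S x = volume S := by
  have hT : MeasurableSet {p : Plane × ℝ | p.1 + l • arc p.2 ∈ S} := hS.preimage (by fun_prop)
  have e1 := Measure.prod_apply (μ := (volume : Measure Plane))
    (ν := volume.restrict (Ioo (0 : ℝ) 1)) hT
  rw [Measure.prod_apply_symm hT] at e1
  refine e1.symm.trans ?_
  have : ∀ t : ℝ, volume ((fun x : Plane => (x, t)) ⁻¹' {p : Plane × ℝ | p.1 + l • arc p.2 ∈ S})
      = volume S := fun t => measure_preimage_add_right volume (l • arc t) S
  simp only [this, lintegral_const, measure_univ, mul_one]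

/-- The second moment of the arc average counts pairs of points of `S` whose difference is
distributed by the dilated difference law. -/
lemma lintegral_arcAverage_sq (l : ℝ) {S : Set Plane} (hS : MeasurableSet S) :
    ∫⁻ x, arcAverage l S x ^ 2 = ∫⁻ x in S, arcDifferenceLaw {w | x + l • w ∈ S} := by
  set ν : Measure ℝ := volume.restrict (Ioo (0 : ℝ) 1) with hν
  have hT : MeasurableSet {p : Plane × (ℝ × ℝ) |
      p.1 + l • arc p.2.1 ∈ S ∧ p.1 + l • arc p.2.2 ∈ S} :=
    (hS.preimage (by fun_prop : Measurable fun p : Plane × (ℝ × ℝ) => p.1 + l • arc p.2.1)).inter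
      (hS.preimage (by fun_prop : Measurable fun p : Plane × (ℝ × ℝ) => p.1 + l • arc p.2.2))
  have hU : MeasurableSet {p : Plane × (ℝ × ℝ) | p.1 + l • (arc p.2.1 - arc p.2.2) ∈ S} :=
    hS.preimage (by fun_prop)
  calc ∫⁻ x, arcAverage l S x ^ 2
      = ∫⁻ x, (ν.prod ν) {z | x + l • arc z.1 ∈ S ∧ x + l • arc z.2 ∈ S} := by
        refine lintegral_congr fun x => ?_
        rw [sq]
        exact (Measure.prod_prod _ _).symm
    _ = ∫⁻ z, volume {x | x + l • arc z.1 ∈ S ∧ x + l • arc z.2 ∈ S} ∂(ν.prod ν) :=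
        (Measure.prod_apply hT).symm.trans (Measure.prod_apply_symm hT)
    _ = ∫⁻ z, volume.restrict S {y | y + l • (arc z.1 - arc z.2) ∈ S} ∂(ν.prod ν) := by
        refine lintegral_congr fun z => ?_
        rw [Measure.restrict_apply' hS, ← measure_preimage_add_right volume (l • arc z.2)
          ({y | y + l • (arc z.1 - arc z.2) ∈ S} ∩ S)]
        congr 1
        ext x
        simp only [mem_ofPred_eq, mem_inter_iff, mem_preimage]
        rw [show x + l • arc z.2 + l • (arc z.1 - arc z.2) = x + l • arc z.1 by
          rw [smul_sub]; abel]
    _ = ∫⁻ y in S, (ν.prod ν) {z | y + l • (arc z.1 - arc z.2) ∈ S} :=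
        (Measure.prod_apply_symm hU).symm.trans (Measure.prod_apply hU)
    _ = _ := by
        refine lintegral_congr fun y => ?_
        have hm : MeasurableSet {w : Plane | y + l • w ∈ S} := hS.preimage (by fun_prop)
        rw [arcDifferenceLaw, Measure.map_apply (by fun_prop) hm]
        rfl

/-- Second moment estimate. If `S` fills at least the proportion `δ - ε` of a cube of side `R`
much larger than `l`, while the dilated difference law never sees a proportion of `S` larger than
`δ + ε`, then arc averages at distance `l` exceed `δ / 2` at all points of `S` up to a set of
small measure. -/
lemma volume_arcAverage_lt_le {S : Set Plane} (hS : MeasurableSet S) {x₀ : Plane} {R l δ ε : ℝ}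
    (hSQ : S ⊆ cornerCube x₀ R) (hl : 0 < l) (hR : 0 < R) (hδ : 0 < δ) (hδ1 : δ ≤ 1) (hε : 0 < ε)
    (hεδ : ε ≤ δ) (hlR : (R + l) ^ 2 ≤ (1 + ε) * R ^ 2)
    (hlow : ENNReal.ofReal ((δ - ε) * R ^ 2) ≤ volume S)
    (hup : ∀ x, arcDifferenceLaw {w | x + l • w ∈ S} ≤ ENNReal.ofReal (δ + ε)) :
    volume {x ∈ S | arcAverage l S x < ENNReal.ofReal (δ / 2)} ≤
      ENNReal.ofReal (12 * ε / δ ^ 2 * R ^ 2) := by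
  set B : Set Plane := {x ∈ S | arcAverage l S x < ENNReal.ofReal (δ / 2)} with hB
  have hBm : MeasurableSet B :=
    hS.inter (measurableSet_lt (measurable_arcAverage l hS) measurable_const)
  set Q : Set Plane := cornerCube (x₀ - l • WithLp.toLp 2 1) (R + l) with hQ
  have hQm : MeasurableSet Q := measurableSet_cornerCube _ _
  have hSQ' : S ⊆ Q := fun x hx i => by
    have := hSQ hx i
    simp only [mem_Icc, PiLp.sub_apply, PiLp.smul_apply, Pi.one_apply, smul_eq_mul, mul_one]
      at this ⊢
    constructor <;> linarith [this.1, this.2]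
  have hsupp : ∀ x ∉ Q, arcAverage l S x = 0 := fun x hx => by
    refine (Measure.restrict_apply' measurableSet_Ioo).trans ?_
    convert measure_empty (μ := (volume : Measure ℝ))
    refine eq_empty_of_forall_notMem fun t ht => hx fun i => ?_
    have h1 := hSQ ht.1 i
    have h2 := arc_mem_Icc ht.2 i
    simp only [mem_Icc, PiLp.sub_apply, PiLp.add_apply, PiLp.smul_apply, Pi.one_apply,
      smul_eq_mul, mul_one] at h1 h2 ⊢
    constructor <;> nlinarith [h1.1, h1.2, h2.1, h2.2]
  have hSfin : volume S ≠ ∞ := measure_ne_top_of_subset hSQ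
    (by rw [volume_cornerCube _ hR.le]; exact ENNReal.ofReal_ne_top)
  have hBfin : volume B ≠ ∞ := measure_ne_top_of_subset (sep_subset _ _) hSfin
  -- The expansion of `(F - δ)² ≥ (δ / 2)² 1_B`, without subtraction.
  have hpt : ∀ x, ENNReal.ofReal (2 * δ) * arcAverage l S x
      + B.indicator (fun _ => ENNReal.ofReal (δ ^ 2 / 4)) x
      ≤ arcAverage l S x ^ 2 + Q.indicator (fun _ => ENNReal.ofReal (δ ^ 2)) x := by
    intro x
    by_cases hx : x ∈ Q
    · have hF : arcAverage l S x ≠ ∞ := ne_top_of_le_ne_top ENNReal.one_ne_top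
        (arcAverage_le_one l S x)
      obtain ⟨f, hf0, hf⟩ : ∃ f : ℝ, 0 ≤ f ∧ arcAverage l S x = ENNReal.ofReal f :=
        ⟨_, ENNReal.toReal_nonneg, (ENNReal.ofReal_toReal hF).symm⟩
      rw [indicator_of_mem hx, hf, ← ENNReal.ofReal_pow hf0,
        ← ENNReal.ofReal_mul (by positivity), ← ENNReal.ofReal_add (by positivity) (by positivity)]
      by_cases hxB : x ∈ B
      · have h := hxB.2
        rw [hf, ENNReal.ofReal_lt_ofReal_iff (by positivity)] at h
        rw [indicator_of_mem hxB, ← ENNReal.ofReal_add (by positivity) (by positivity)]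
        exact ENNReal.ofReal_le_ofReal (by nlinarith)
      · rw [indicator_of_notMem hxB, add_zero]
        exact ENNReal.ofReal_le_ofReal (by nlinarith [sq_nonneg (f - δ)])
    · have hxB : x ∉ B := fun h => hx (hSQ' h.1)
      simp [hsupp x hx, hx, hxB]
  have hint := lintegral_mono (μ := volume) hpt
  rw [lintegral_add_right _ (measurable_const.indicator hBm),
    lintegral_add_right _ (measurable_const.indicator hQm),
    lintegral_const_mul _ (measurable_arcAverage l hS), lintegral_arcAverage l hS,
    lintegral_indicator_const hBm, lintegral_indicator_const hQm,
    lintegral_arcAverage_sq l hS, volume_cornerCube _ (by positivity)] at hint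
  have hsq : ∫⁻ x in S, arcDifferenceLaw {w | x + l • w ∈ S} ≤
      ENNReal.ofReal (δ + ε) * volume S := by
    calc _ ≤ ∫⁻ x in S, ENNReal.ofReal (δ + ε) := lintegral_mono fun x => hup x
      _ = _ := by simp
  replace hint := hint.trans (add_le_add_left hsq _)
  obtain ⟨m, hm0, hm⟩ : ∃ m : ℝ, 0 ≤ m ∧ volume S = ENNReal.ofReal m :=
    ⟨_, ENNReal.toReal_nonneg, (ENNReal.ofReal_toReal hSfin).symm⟩
  obtain ⟨b, hb0, hb⟩ : ∃ b : ℝ, 0 ≤ b ∧ volume B = ENNReal.ofReal b :=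
    ⟨_, ENNReal.toReal_nonneg, (ENNReal.ofReal_toReal hBfin).symm⟩
  rw [hm, ENNReal.ofReal_le_ofReal_iff hm0] at hlow
  rw [hm, hb, ← ENNReal.ofReal_mul (by positivity), ← ENNReal.ofReal_mul (by positivity),
    ← ENNReal.ofReal_mul (by positivity), ← ENNReal.ofReal_mul (by positivity),
    ← ENNReal.ofReal_add (by positivity) (by positivity),
    ← ENNReal.ofReal_add (by positivity) (by positivity),
    ENNReal.ofReal_le_ofReal_iff (by positivity)] at hint
  rw [hb]
  refine ENNReal.ofReal_le_ofReal ?_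
  have h1 : δ ^ 2 / 4 * b ≤ 3 * ε * R ^ 2 := by
    have a1 : (δ - ε) * ((δ - ε) * R ^ 2) ≤ (δ - ε) * m :=
      mul_le_mul_of_nonneg_left hlow (by linarith)
    have a2 : δ ^ 2 * (R + l) ^ 2 ≤ δ ^ 2 * ((1 + ε) * R ^ 2) :=
      mul_le_mul_of_nonneg_left hlR (by positivity)
    have a3 : (2 * δ * ε - ε ^ 2 + δ ^ 2 * ε) * R ^ 2 ≤ 3 * ε * R ^ 2 :=
      mul_le_mul_of_nonneg_right (by nlinarith [mul_nonneg hε.le (sub_nonneg.2 hδ1)])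
        (by positivity)
    nlinarith
  rw [div_mul_eq_mul_div, le_div_iff₀ (by positivity)]
  linarith

/-! ### Cubes of extremal density -/

lemma upperBanachDensity_congr {d : ℕ} {A B : Set (EuclideanSpace ℝ (Fin d))}
    (h : A =ᵐ[volume] B) : upperBanachDensity A = upperBanachDensity B := by
  unfold upperBanachDensity
  congr 1
  ext R
  congr 1
  ext x
  rw [measure_congr (h.inter (ae_eq_refl (cornerCube x R)))]

lemma upperBanachDensity_le_one {d : ℕ} (A : Set (EuclideanSpace ℝ (Fin d))) :
    upperBanachDensity A ≤ 1 := by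
  refine limsup_le_of_le (h := ?_)
  filter_upwards [eventually_ge_atTop 0] with R hR
  refine iSup_le fun x => ENNReal.div_le_of_le_mul ?_
  rw [one_mul, ← volume_cornerCube x hR]
  exact measure_mono inter_subset_right

/-- All sufficiently large cubes have density at most `κ`, for `κ` above the upper Banach
density. -/
lemma exists_forall_volume_inter_cornerCube_le {d : ℕ} {A : Set (EuclideanSpace ℝ (Fin d))}
    {κ : ℝ} (hκ : 0 ≤ κ) (h : upperBanachDensity A < ENNReal.ofReal κ) :
    ∃ L₀ : ℝ, ∀ L, L₀ ≤ L → ∀ x, volume (A ∩ cornerCube x L) ≤ ENNReal.ofReal (κ * L ^ d) := by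
  have := (eventually_lt_of_limsup_lt h).and (eventually_gt_atTop (0 : ℝ))
  obtain ⟨L₀, hL₀⟩ := eventually_atTop.1 this
  refine ⟨L₀, fun L hL x => ?_⟩
  obtain ⟨h1, h2⟩ := hL₀ L hL
  have h3 := (le_iSup _ x).trans h1.le
  rwa [ENNReal.div_le_iff (by simpa using pow_pos h2 d) ENNReal.ofReal_ne_top,
    ← ENNReal.ofReal_mul hκ] at h3

/-- Arbitrarily large cubes have density at least `κ`, for `κ` below the upper Banach density. -/
lemma frequently_exists_le_volume_inter_cornerCube {d : ℕ} {A : Set (EuclideanSpace ℝ (Fin d))}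
    {κ : ℝ} (hκ : 0 ≤ κ) (h : ENNReal.ofReal κ < upperBanachDensity A) :
    ∃ᶠ R : ℝ in atTop, ∃ x, ENNReal.ofReal (κ * R ^ d) ≤ volume (A ∩ cornerCube x R) := by
  refine ((frequently_lt_of_lt_limsup (h := h)).and_eventually
    (eventually_gt_atTop (0 : ℝ))).mono fun R hR => ?_
  obtain ⟨x, hx⟩ := lt_iSup_iff.1 hR.1
  refine ⟨x, ?_⟩
  have h3 := hx.le
  rwa [ENNReal.le_div_iff_mul_le (Or.inl (by simpa using pow_pos hR.2 d))
    (Or.inl ENNReal.ofReal_ne_top), ← ENNReal.ofReal_mul hκ] at h3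

/-! ### Nested sets with many neighbours -/

lemma infinite_setOf_dist_eq {l : ℝ} (hl : 0 < l) {S : Set Plane} {x : Plane}
    (h : arcAverage l S x ≠ 0) : {y ∈ S | dist x y = l}.Infinite := by
  intro hfin
  refine h ((Measure.restrict_apply' measurableSet_Ioo).trans ?_)
  have hinj : Function.Injective fun t => x + l • arc t := fun s t hst =>
    arc_injective (smul_right_injective Plane hl.ne' (add_left_cancel hst))
  refine ((hfin.preimage hinj.injOn).subset fun t ht => ⟨ht.1, ?_⟩).measure_zero _
  rw [dist_self_add_right, norm_smul, norm_arc ht.2, Real.norm_eq_abs, abs_of_pos hl, mul_one]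

/-- Points of `S` without suitable neighbours can be discarded repeatedly. If the arc averages of
`S` at the distances `l k` are at least `c` up to sets of measure `v`, there is a decreasing
sequence of sets starting at `S` such that points of each set have, at every distance `l k`, a
positive proportion of neighbours in the preceding set; the measure lost grows by a bounded factor
in each step, because arc averaging preserves total mass. -/
lemma exists_nested_sets {K : Type*} [Finite K] {l : K → ℝ} {S : Set Plane}
    (hS : MeasurableSet S) {c v : ℝ≥0∞} (hc : c ≠ 0) (hc' : c ≠ ∞)
    (h : ∀ k, volume {x ∈ S | arcAverage (l k) S x < c} ≤ v) :
    ∃ s : ℕ → Set Plane, (∀ n, s n ⊆ S) ∧ (∀ n, s (n + 1) ⊆ s n) ∧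
      (∀ n, ∀ x ∈ s (n + 1), ∀ k, arcAverage (l k) (s n) x ≠ 0) ∧
      ∀ n, volume (S \ s n) ≤ (1 + Nat.card K * (1 + c⁻¹)) ^ n * v := by
  have := Fintype.ofFinite K
  let f : Set Plane → Set Plane := fun T => {x ∈ T | ∀ k, arcAverage (l k) T x ≠ 0}
  let s : ℕ → Set Plane := fun n => f^[n] S
  have hs : ∀ n, s (n + 1) = f (s n) := fun n => Function.iterate_succ_apply' f n S
  have hsub : ∀ n, s (n + 1) ⊆ s n := fun n => by rw [hs]; exact sep_subset _ _
  have hsS : ∀ n, s n ⊆ S := fun n => by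
    induction n with
    | zero => exact subset_rfl
    | succ n ih => exact (hsub n).trans ih
  have hm : ∀ n, MeasurableSet (s n) := fun n => by
    induction n with
    | zero => exact hS
    | succ n ih =>
      rw [hs]
      refine ih.inter ?_
      have : MeasurableSet (⋂ k, {x | arcAverage (l k) (s n) x ≠ 0}) := MeasurableSet.iInter
        fun k => (measurable_arcAverage (l k) ih) (measurableSet_singleton 0).compl
      have heq : {x | ∀ k, arcAverage (l k) (s n) x ≠ 0} =
          ⋂ k, {x | arcAverage (l k) (s n) x ≠ 0} := by
        ext x
        simp
      rw [← heq] at this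
      exact this
  refine ⟨s, hsS, hsub, fun n x hx k => ?_, fun n => ?_⟩
  · rw [hs] at hx
    exact hx.2 k
  suffices volume (S \ s n) + v ≤ (1 + Nat.card K * (1 + c⁻¹)) ^ n * v from
    le_self_add.trans this
  induction n with
  | zero => simp [s]
  | succ n ih =>
    set w := volume (S \ s n)
    have hcover : S \ s (n + 1) ⊆ (S \ s n) ∪ ⋃ k,
        ({x ∈ S | arcAverage (l k) S x < c} ∪ {x | c ≤ arcAverage (l k) (S \ s n) x}) := by
      rintro x ⟨hxS, hx⟩
      by_cases hxn : x ∈ s n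
      · rw [hs] at hx
        have : ∃ k, arcAverage (l k) (s n) x = 0 := by
          by_contra! hcon
          exact hx ⟨hxn, hcon⟩
        obtain ⟨k, hk⟩ := this
        refine Or.inr (mem_iUnion.2 ⟨k, ?_⟩)
        by_cases hlt : arcAverage (l k) S x < c
        · exact Or.inl ⟨hxS, hlt⟩
        · refine Or.inr ((not_lt.1 hlt).trans ?_)
          calc arcAverage (l k) S x
              ≤ arcAverage (l k) (s n) x + arcAverage (l k) (S \ s n) x := by
                refine (measure_mono fun t ht => ?_).trans (measure_union_le _ _)
                by_cases htn : x + l k • arc t ∈ s n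
                · exact Or.inl htn
                · exact Or.inr ⟨ht, htn⟩
            _ = _ := by rw [hk, zero_add]
      · exact Or.inl ⟨hxS, hxn⟩
    have hmarkov : ∀ k, volume {x | c ≤ arcAverage (l k) (S \ s n) x} ≤ c⁻¹ * w := fun k => by
      have := mul_meas_ge_le_lintegral (μ := volume)
        (measurable_arcAverage (l k) (hS.diff (hm n))) c
      rw [lintegral_arcAverage _ (hS.diff (hm n))] at this
      rwa [← ENNReal.div_eq_inv_mul, ENNReal.le_div_iff_mul_le (Or.inl hc) (Or.inl hc'), mul_comm]
    calc volume (S \ s (n + 1)) + v ≤ (w + ∑ _k : K, (v + c⁻¹ * w)) + v := by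
          gcongr
          refine (measure_mono hcover).trans ((measure_union_le _ _).trans ?_)
          gcongr
          refine (measure_iUnion_fintype_le _ _).trans (Finset.sum_le_sum fun k _ => ?_)
          exact (measure_union_le _ _).trans (add_le_add (h k) (hmarkov k))
      _ = w + v + Nat.card K * (v + c⁻¹ * w) := by
          rw [Finset.sum_const, Finset.card_univ, Nat.card_eq_fintype_card, nsmul_eq_mul]
          ring
      _ ≤ w + v + Nat.card K * ((1 + c⁻¹) * (w + v)) := by
          gcongr
          rw [add_mul, one_mul, mul_add]
          exact add_le_add le_add_self le_self_add
      _ = (1 + Nat.card K * (1 + c⁻¹)) * (w + v) := by ring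
      _ ≤ (1 + Nat.card K * (1 + c⁻¹)) * ((1 + Nat.card K * (1 + c⁻¹)) ^ n * v) := by gcongr
      _ = _ := by rw [pow_succ]; ring

/-! ### Embedding trees -/

universe u in
/-- A tree with `n + 1` vertices embeds into a metric space with prescribed edge lengths from `D`
as soon as there are nested sets `s m ⊇ s (m + 1) ⊇ ⋯ ⊇ s (m + n) ≠ ∅` such that points of each set
have infinitely many neighbours in the preceding set at every distance from `D`. The leaves are
attached one at a time; having infinitely many candidates keeps the vertices distinct. -/
lemma exists_embedding_of_isTree {X : Type*} [MetricSpace X] {s : ℕ → Set X} {D : Set ℝ}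
    (hs : ∀ n, s (n + 1) ⊆ s n)
    (hinf : ∀ n, ∀ x ∈ s (n + 1), ∀ r ∈ D, {y ∈ s n | dist x y = r}.Infinite) (n : ℕ) :
    ∀ (m : ℕ) {V : Type u} [Finite V] {G : SimpleGraph V}, G.IsTree → Nat.card V = n + 1 →
      ∀ len : V → V → ℝ, (∀ u v, len u v = len v u) → (∀ u v, G.Adj u v → len u v ∈ D) →
      (s (m + n)).Nonempty →
      ∃ x : V → X, Function.Injective x ∧ (∀ v, x v ∈ s m) ∧
        ∀ u v, G.Adj u v → dist (x u) (x v) = len u v := by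
  induction n with
  | zero =>
    intro m V _ G hG hcard len _ _ ⟨p, hp⟩
    have : Subsingleton V := (Nat.card_eq_one_iff_unique.1 hcard).1
    exact ⟨fun _ => p, Function.injective_of_subsingleton _, fun _ => hp,
      fun u v huv => absurd (Subsingleton.elim u v) huv.ne⟩
  | succ n ih =>
    intro m V _ G hG hcard len hsymm hlen hne
    classical
    have := Fintype.ofFinite V
    have : Nontrivial V := Finite.one_lt_card_iff_nontrivial.1 (by omega)
    obtain ⟨v, hv⟩ := hG.exists_vert_degree_one_of_nontrivial
    obtain ⟨u, huv, hu⟩ := SimpleGraph.degree_eq_one_iff_existsUnique_adj.1 hv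
    have hG' : (G.induce {v}ᶜ).IsTree :=
      ⟨hG.connected.induce_compl_singleton_of_degree_eq_one hv, hG.isAcyclic.induce _⟩
    have hcard' : Nat.card ({v}ᶜ : Set V) = n + 1 := by
      have := Set.ncard_add_ncard_compl ({v} : Set V)
      rw [Set.ncard_singleton, hcard] at this
      rw [Nat.card_coe_set_eq]
      omega
    obtain ⟨x, hxinj, hxs, hx⟩ := ih (m + 1) hG' hcard' (fun a b => len a b)
      (fun a b => hsymm a b) (fun a b hab => hlen a b hab)
      (by rwa [show m + 1 + n = m + (n + 1) by ring])
    have hu' : u ∈ ({v}ᶜ : Set V) := huv.ne'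
    obtain ⟨y, ⟨hys, hyd⟩, hyx⟩ := (hinf m (x ⟨u, hu'⟩) (hxs _) (len u v)
      (hlen u v huv.symm)).exists_notMem_finite (Set.finite_range x)
    have hyx' : ∀ w, x w ≠ y := fun w hw => hyx ⟨w, hw⟩
    refine ⟨fun w => if h : w = v then y else x ⟨w, h⟩, ?_, fun w => ?_, ?_⟩
    · intro a b hab
      by_cases ha : a = v <;> by_cases hb : b = v <;> simp only [ha, hb, dite_true, dite_false] at hab
      · rw [ha, hb]
      · exact absurd hab.symm (hyx' _)
      · exact absurd hab (hyx' _)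
      · exact congrArg Subtype.val (hxinj hab)
    · by_cases hw : w = v
      · simpa [hw] using hys
      · simpa [hw] using hs m (hxs _)
    · intro a b hab
      by_cases ha : a = v <;> by_cases hb : b = v
      · exact absurd (ha.trans hb.symm) hab.ne
      · obtain rfl : b = u := hu b (ha ▸ hab)
        simp only [ha, hb, dite_true, dite_false]
        rw [dist_comm, hyd, hsymm]
      · obtain rfl : a = u := hu a (hb ▸ hab.symm)
        simp only [ha, hb, dite_true, dite_false]
        exact hyd
      · simp only [ha, hb, dite_false]
        exact hx ⟨a, ha⟩ ⟨b, hb⟩ hab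

/-! ### Sets of positive upper Banach density -/

lemma eventually_add_sq_le {ε : ℝ} (hε : 0 < ε) (l : ℝ) :
    ∀ᶠ R : ℝ in atTop, (R + l) ^ 2 ≤ (1 + ε) * R ^ 2 := by
  filter_upwards [eventually_ge_atTop |l|, eventually_ge_atTop (3 * |l| / ε)] with R h1 h2
  rw [div_le_iff₀ hε] at h2
  have h3 := abs_nonneg l
  nlinarith [le_abs_self l, sq_abs l]

/-- For a set of positive upper Banach density, all sufficiently large distances `l k` and any
depth `n`, there are nested nonempty subsets of depth `n` whose points have infinitely many
neighbours at each of these distances in the preceding set. -/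
lemma exists_nested_sets_of_upperBanachDensity_pos {A : Set Plane} (hA : MeasurableSet A)
    (hdens : 0 < upperBanachDensity A) (K : Type*) [Finite K] (n : ℕ) :
    ∃ l₀ : ℝ, 0 < l₀ ∧ ∀ l : K → ℝ, (∀ k, l₀ ≤ l k) → ∃ s : ℕ → Set Plane,
      (∀ m, s m ⊆ A) ∧ (∀ m, s (m + 1) ⊆ s m) ∧
      (∀ m, ∀ x ∈ s (m + 1), ∀ k, {y ∈ s m | dist x y = l k}.Infinite) ∧ (s n).Nonempty := by
  have hfin : upperBanachDensity A ≠ ∞ :=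
    ne_top_of_le_ne_top ENNReal.one_ne_top (upperBanachDensity_le_one A)
  obtain ⟨δ, hδA⟩ : ∃ δ : ℝ, upperBanachDensity A = ENNReal.ofReal δ :=
    ⟨_, (ENNReal.ofReal_toReal hfin).symm⟩
  have hδ : 0 < δ := by rwa [hδA, ENNReal.ofReal_pos] at hdens
  have hδ1 : δ ≤ 1 := by
    have := upperBanachDensity_le_one A
    rwa [hδA, ENNReal.ofReal_le_one] at this
  -- `M` bounds the factor by which the discarded measure grows in each step.
  set M : ℝ := 1 + Nat.card K * (1 + (δ / 2)⁻¹) with hM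
  have hM0 : 0 < M := by positivity
  obtain ⟨ε, hε, hεδ, hεM⟩ : ∃ ε : ℝ, 0 < ε ∧ ε ≤ δ / 2 ∧ M ^ n * (12 * ε / δ ^ 2) ≤ δ / 4 := by
    refine ⟨min (δ / 2) (δ ^ 3 / (48 * M ^ n)), by positivity, min_le_left _ _, ?_⟩
    have h := min_le_right (δ / 2) (δ ^ 3 / (48 * M ^ n))
    rw [le_div_iff₀ (by positivity)] at h
    rw [← mul_div_assoc, div_le_iff₀ (by positivity)]
    linarith
  obtain ⟨L₀, hL₀⟩ := exists_forall_volume_inter_cornerCube_le (A := A) (κ := δ + ε / 2)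
    (by positivity) (by
      rw [hδA]
      exact (ENNReal.ofReal_lt_ofReal_iff (by positivity)).2 (by linarith))
  obtain ⟨l₀, hl₀, hlaw⟩ := exists_forall_dilated_law_le (ρ := arcDifferenceLaw)
    arc_difference_absolutelyContinuous hA (by positivity) hL₀ (half_pos hε)
  refine ⟨l₀, hl₀, fun l hl => ?_⟩
  have hfreq := frequently_exists_le_volume_inter_cornerCube (A := A) (κ := δ - ε)
    (by linarith) (by
      rw [hδA]
      exact (ENNReal.ofReal_lt_ofReal_iff hδ).2 (by linarith))
  obtain ⟨R, ⟨x₀, hx₀⟩, hR, hRl⟩ := (hfreq.and_eventually ((eventually_gt_atTop (0 : ℝ)).and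
    (eventually_all.2 fun k => eventually_add_sq_le hε (l k)))).exists
  have hS : MeasurableSet (A ∩ cornerCube x₀ R) := hA.inter (measurableSet_cornerCube _ _)
  have hbad : ∀ k, volume {x ∈ A ∩ cornerCube x₀ R |
      arcAverage (l k) (A ∩ cornerCube x₀ R) x < ENNReal.ofReal (δ / 2)} ≤
      ENNReal.ofReal (12 * ε / δ ^ 2 * R ^ 2) := fun k =>
    volume_arcAverage_lt_le hS inter_subset_right (hl₀.trans_le (hl k)) hR hδ hδ1 hε
      (by linarith) (hRl k) hx₀ fun x => by
        refine (measure_mono fun w hw => hw.1).trans ((hlaw (l k) (hl k) x).trans_eq ?_)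
        rw [add_assoc, add_halves]
  obtain ⟨s, hsS, hs, hpos, hvol⟩ := exists_nested_sets (l := l) hS
    (ENNReal.ofReal_pos.2 (half_pos hδ)).ne' ENNReal.ofReal_ne_top hbad
  refine ⟨s, fun m => (hsS m).trans inter_subset_left, hs, fun m x hx k =>
    infinite_setOf_dist_eq (hl₀.trans_le (hl k)) (hpos m x hx k), ?_⟩
  by_contra hempty
  rw [not_nonempty_iff_eq_empty] at hempty
  have h1 := hvol n
  have h2 : (1 + (Nat.card K : ℝ≥0∞) * (1 + (ENNReal.ofReal (δ / 2))⁻¹)) = ENNReal.ofReal M := by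
    rw [hM, ENNReal.ofReal_add one_pos.le (by positivity), ENNReal.ofReal_mul (by positivity),
      ENNReal.ofReal_add one_pos.le (by positivity), ENNReal.ofReal_one, ENNReal.ofReal_natCast,
      ENNReal.ofReal_inv_of_pos (half_pos hδ)]
  rw [hempty, sdiff_empty, h2, ← ENNReal.ofReal_pow hM0.le,
    ← ENNReal.ofReal_mul (by positivity)] at h1
  have h3 := (ENNReal.ofReal_le_ofReal_iff (by positivity)).1 (hx₀.trans h1)
  rw [← mul_assoc] at h3
  have h4 := le_of_mul_le_mul_right h3 (by positivity)
  linarith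

theorem theorem3 {V : Type*} [Finite V] (T : SimpleGraph V) (hT : T.IsTree)
    (a b : T.edgeSet → ℝ) (ha : ∀ k, 0 < a k) (hb : ∀ k, 0 < b k)
    (A : Set (EuclideanSpace ℝ (Fin 2)))
    (hA : MeasureTheory.NullMeasurableSet A MeasureTheory.volume)
    (hdens : 0 < upperBanachDensity A) :
    ∃ lam₀ : ℝ, 0 < lam₀ ∧ ∀ lam : ℝ, lam₀ ≤ lam →
      ∃ x : V → EuclideanSpace ℝ (Fin 2),
        Function.Injective x ∧ (∀ v, x v ∈ A) ∧
        ∀ (k : T.edgeSet) (u v : V), (k : Sym2 V) = s(u, v) →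
          ‖x u - x v‖ = lam ^ (a k) * b k := by
  classical
  obtain ⟨B, hBA, hB, hBae⟩ := hA.exists_measurable_subset_ae_eq
  rw [← upperBanachDensity_congr hBae] at hdens
  have : Nonempty V := hT.connected.nonempty
  obtain ⟨n, hn⟩ : ∃ n, Nat.card V = n + 1 := Nat.exists_eq_succ_of_ne_zero Nat.card_pos.ne'
  obtain ⟨l₀, -, H⟩ := exists_nested_sets_of_upperBanachDensity_pos hB hdens T.edgeSet n
  have hev : ∀ᶠ lam : ℝ in atTop, ∀ k, l₀ ≤ lam ^ a k * b k := eventually_all.2 fun k =>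
    ((tendsto_rpow_atTop (ha k)).atTop_mul_const (hb k)).eventually_ge_atTop l₀
  obtain ⟨lam₀, hlam₀⟩ := eventually_atTop.1 hev
  refine ⟨max 1 lam₀, by positivity, fun lam hlam => ?_⟩
  obtain ⟨s, hsB, hs, hinf, hne⟩ := H _ (hlam₀ lam ((le_max_right _ _).trans hlam))
  -- Edge lengths as a symmetric function of pairs of vertices, with value `0` off the edges.
  let len : Sym2 V → ℝ := fun e => if h : e ∈ T.edgeSet then lam ^ a ⟨e, h⟩ * b ⟨e, h⟩ else 0
  obtain ⟨x, hx, hxs, hxd⟩ := exists_embedding_of_isTree (D := Set.range fun k => lam ^ a k * b k)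
    hs (by rintro m y hy _ ⟨k, rfl⟩; exact hinf m y hy k) n 0 hT hn (fun u v => len s(u, v))
    (fun u v => by rw [Sym2.eq_swap])
    (fun u v huv => ⟨⟨s(u, v), huv⟩, by simp [len, huv]⟩) (by rwa [zero_add])
  refine ⟨x, hx, fun v => hBA (hsB 0 (hxs v)), ?_⟩
  rintro ⟨_, hk⟩ u v rfl
  rw [← dist_eq_norm, hxd u v hk]
  exact dif_pos hk
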